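/- Let $K$ be a field of characteristic $0$, let $X$ be a smooth scheme over $K$, and write $\Omega=\Omega_{X/K}$. Let $\mathrm{D}^+(X)$ be the derived category of bounded below complexes of $\mathcal O_X$-modules. For an $\mathcal O_X$-module $E$ let $J_1(E)=p_{2*}(p_1^*E\otimes\mathcal O_{X\times_K X}/\mathcal I^2)$ be the sheaf of first jets, where $\mathcal I$ is the ideal of the diagonal; on an open affine $\operatorname{Spec}R$ on which $E$ is given by an $R$-module $M$ it is $M\otimes_R (R\otimes_K R)/I^2$, the tensor product being formed along the first factor of $R\otimes_K R$ and $R$ acting through the second factor. There is a functorial exact sequence $0\to E\otimes\Omega\xrightarrow{f}J_1(E)\xrightarrow{g}E\to 0$ with $f(m\otimes dr)=m\otimes[r\otimes 1-1\otimes r]$ and $g(m\otimes[a\otimes b])=abm$. A connection on $E$ is a $K$-linear morphism of sheaves $\nabla:E\to E\otimes\Omega$ with $\nabla(re)=r\nabla e+e\otimes dr$ for all local sections $r$ of $\mathcal O_X$ and $e$ of $E$. Let $E^\bullet$ be a bounded below complex of vector bundles (locally free $\mathcal O_X$-modules of finite rank) on $X$ with differential $d$. Let $E^\bullet\otimes\Omega[1]$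 be the complex with $E^{n+1}\otimes\Omega$ in degree $n$ and differential $d\otimes 1$ (without a sign), and let $\mathrm{Tot}=\mathrm{Tot}(E^\bullet\otimes\Omega\to J_1(E^\bullet))$ be the complex with $\mathrm{Tot}^n=J_1(E^n)\oplus (E^{n+1}\otimes\Omega)$ and differential $(x,y)\mapsto (dx+(-1)^nf(y),\,dy)$ on $\mathrm{Tot}^n$. The morphism of complexes $Q:\mathrm{Tot}\to E^\bullet$, $(x,y)\mapsto g(x)$, is a quasi-isomorphism, and $R:\mathrm{Tot}\to E^\bullet\otimes\Omega[1]$, $(x,y)\mapsto y$, is a morphism of complexes. The Atiyah class of $E^\bullet$ is $$\alpha(E^\bullet)=R\circ Q^{-1}\in\operatorname{Hom}_{\mathrm{D}^+(X)}(E^\bullet,E^\bullet\otimes\Omega[1]).$$ Suppose that every term $E^n$ has a global connection $\nabla_n:E^n\to E^n\otimes\Omega$. Then the maps $$\theta_n=(-1)^n\bigl(-\nabla_{n+1}\,d+(d\otimes 1)\nabla_n\bigr):E^n\to E^{n+1}\otimes\Omega$$ are $\mathcal O_X$-linear and form a morphism of complexes $\theta:E^\bullet\to E^\bullet\otimes\Omega[1]$,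 and $\alpha(E^\bullet)$ is the class of $\theta$ in $\operatorname{Hom}_{\mathrm{D}^+(X)}(E^\bullet,E^\bullet\otimes\Omega[1])$. -/

import Mathlib

open scoped TensorProduct

noncomputable section

section Ring
universe u
variable (k R : Type u) [CommRing k] [CommRing R] [Algebra k R]

/-- The ring `(R ⊗ₖ R) ⧸ I²`. -/
abbrev FirstOrder : Type u := (R ⊗[k] R) ⧸ (KaehlerDifferential.ideal k R) ^ 2

namespace FirstOrder

/-- The quotient map. -/
abbrev mk : R ⊗[k] R →ₐ[R] FirstOrder k R := Ideal.Quotient.mkₐ R _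

/-- The second inclusion `r ↦ [1 ⊗ r]`; the first one, `r ↦ [r ⊗ 1]`, is the `algebraMap`. -/
def right : R →+* FirstOrder k R :=
  (mk k R : R ⊗[k] R →+* FirstOrder k R).comp
    (Algebra.TensorProduct.includeRight : R →ₐ[k] R ⊗[k] R).toRingHom

lemma right_apply (r : R) : right k R r = mk k R (1 ⊗ₜ r) := rfl

lemma algebraMap_apply (r : R) : algebraMap R (FirstOrder k R) r = mk k R (r ⊗ₜ 1) := rfl

/-- The multiplication map `[a ⊗ b] ↦ a b`. -/
def mul : FirstOrder k R →ₐ[R] R :=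
  Ideal.Quotient.liftₐ _ (Algebra.TensorProduct.lmul'' k (S := R)) (by
    intro x hx
    have := Ideal.pow_le_self (two_ne_zero) hx
    exact this)

@[simp] lemma mul_right (r : R) : mul k R (right k R r) = r :=
  (one_mul r : (1 : R) * r = r)

/-- The inclusion `Ω = I ⧸ I² → (R ⊗ₖ R) ⧸ I²`, `d r ↦ [r ⊗ 1 - 1 ⊗ r]`. -/
def ofDifferential : Ω[R⁄k] →ₗ[R] FirstOrder k R :=
  -((KaehlerDifferential.ideal k R).cotangentToQuotientSquare.restrictScalars R)

lemma ofDifferential_toCotangent (x : KaehlerDifferential.ideal k R) :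
    ofDifferential k R ((KaehlerDifferential.ideal k R).toCotangent x) = - mk k R x := rfl

lemma ofDifferential_D (r : R) :
    ofDifferential k R (KaehlerDifferential.D k R r) = algebraMap R _ r - right k R r := by
  rw [KaehlerDifferential.D_apply, ofDifferential_toCotangent, right_apply, algebraMap_apply,
    ← map_neg, ← map_sub, neg_sub]

lemma right_mul_ofDifferential (r : R) (ω : Ω[R⁄k]) :
    right k R r * ofDifferential k R ω = ofDifferential k R (r • ω) := by
  rw [_root_.map_smul, Algebra.smul_def]
  obtain ⟨⟨x, hx⟩, rfl⟩ := Ideal.toCotangent_surjective _ ω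
  rw [ofDifferential_toCotangent, mul_neg, mul_neg, neg_inj, right_apply, algebraMap_apply,
    ← map_mul, ← map_mul]
  refine Ideal.Quotient.eq.2 ?_
  rw [← sub_mul, pow_two]
  exact Ideal.mul_mem_mul (KaehlerDifferential.one_smul_sub_smul_one_mem_ideal k r) hx

lemma mk_tmul (a b : R) : mk k R (a ⊗ₜ b) = right k R b * algebraMap R _ a := by
  rw [right_apply, algebraMap_apply, ← map_mul, Algebra.TensorProduct.tmul_mul_tmul, one_mul,
    mul_one]

variable {k R} in
lemma add_induction {P : FirstOrder k R → Prop} (h : ∀ a b, P (right k R a * algebraMap R _ b))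
    (hadd : ∀ x y, P x → P y → P (x + y)) (x) : P x := by
  obtain ⟨x, rfl⟩ := Ideal.Quotient.mk_surjective x
  induction x with
  | zero => simpa using h 0 0
  | tmul a b =>
    have := h b a
    rwa [← mk_tmul] at this
  | add x y hx hy => rw [map_add]; exact hadd _ _ hx hy

lemma tensorProductTo_eq_zero {x : R ⊗[k] R} (hx : x ∈ (KaehlerDifferential.ideal k R) ^ 2) :
    (KaehlerDifferential.D k R).tensorProductTo x = 0 := by
  rw [pow_two] at hx
  refine Submodule.mul_induction_on hx (fun x hx y hy => ?_) (fun x y hx hy => ?_)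
  · rw [Derivation.tensorProductTo_mul, (RingHom.mem_ker).1 hx, (RingHom.mem_ker).1 hy]
    simp
  · rw [map_add, hx, hy, add_zero]

/-- The `R`-linear projection `[a ⊗ b] ↦ - a db`. -/
def toDifferential : FirstOrder k R →ₗ[R] Ω[R⁄k] :=
  { QuotientAddGroup.lift ((KaehlerDifferential.ideal k R) ^ 2).toAddSubgroup
      (-(KaehlerDifferential.D k R).tensorProductTo.toAddMonoidHom)
      (fun x hx => neg_eq_zero.2 (tensorProductTo_eq_zero k R hx)) with
    map_smul' := by
      intro r x
      obtain ⟨x, rfl⟩ := Ideal.Quotient.mk_surjective x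
      change -(KaehlerDifferential.D k R).tensorProductTo (r • x) =
        r • -(KaehlerDifferential.D k R).tensorProductTo x
      rw [_root_.map_smul, smul_neg] }

lemma toDifferential_mk (x : R ⊗[k] R) :
    toDifferential k R (mk k R x) = -(KaehlerDifferential.D k R).tensorProductTo x := rfl

lemma toDifferential_apply (a b : R) :
    toDifferential k R (right k R a * algebraMap R _ b) = - (b • KaehlerDifferential.D k R a) := by
  rw [← mk_tmul, toDifferential_mk, Derivation.tensorProductTo_tmul]

lemma toDifferential_ofDifferential (ω : Ω[R⁄k]) :
    toDifferential k R (ofDifferential k R ω) = ω := by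
  obtain ⟨x, rfl⟩ := Ideal.toCotangent_surjective _ ω
  rw [ofDifferential_toCotangent, map_neg, toDifferential_mk, neg_neg,
    KaehlerDifferential.D_tensorProductTo]

lemma ofDifferential_toDifferential (x : FirstOrder k R) :
    algebraMap R _ (mul k R x) + ofDifferential k R (toDifferential k R x) = x := by
  induction x using add_induction with
  | h a b =>
    rw [toDifferential_apply, map_neg, _root_.map_smul, ofDifferential_D, map_mul,
      mul_right, AlgHom.commutes, Algebra.smul_def, map_mul, Algebra.algebraMap_self_apply]
    ring
  | hadd x y hx hy =>
    rw [map_add, map_add, map_add, map_add]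
    conv_rhs => rw [← hx, ← hy]
    exact add_add_add_comm _ _ _ _

lemma mul_ofDifferential (ω : Ω[R⁄k]) : mul k R (ofDifferential k R ω) = 0 := by
  obtain ⟨x, rfl⟩ := Ideal.toCotangent_surjective _ ω
  rw [ofDifferential_toCotangent, map_neg, neg_eq_zero]
  exact x.2

variable {k R} {R' R'' : Type u} [CommRing R'] [Algebra k R'] (σ : R →ₐ[k] R')
  [CommRing R''] [Algebra k R''] (τ : R' →ₐ[k] R'')

/-- The map induced by a morphism of algebras. -/
def map : FirstOrder k R →+* FirstOrder k R' :=
  Ideal.quotientMap _ (Algebra.TensorProduct.map σ σ).toRingHom (by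
    rw [← Ideal.map_le_iff_le_comap, Ideal.map_pow]
    refine Ideal.pow_right_mono (Ideal.map_le_iff_le_comap.2 ?_) 2
    intro x hx
    rw [Ideal.mem_comap, RingHom.mem_ker]
    have : ∀ x, Algebra.TensorProduct.lmul' k (S := R') (Algebra.TensorProduct.map σ σ x) =
      σ (Algebra.TensorProduct.lmul' k (S := R) x) := by
      intro x
      rw [← AlgHom.comp_apply, ← AlgHom.comp_apply]
      congr 1
      ext <;> simp
    have h2 : Algebra.TensorProduct.lmul' k (S := R) x = 0 := hx
    exact (this x).trans (by rw [h2, map_zero]))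

lemma map_mk (x : R ⊗[k] R) : map σ (mk k R x) = mk k R' (Algebra.TensorProduct.map σ σ x) := rfl

@[simp] lemma map_right (r : R) : map σ (right k R r) = right k R' (σ r) := by
  rw [right_apply, right_apply, map_mk, Algebra.TensorProduct.map_tmul, map_one]

@[simp] lemma map_algebraMap (r : R) : map σ (algebraMap R _ r) = algebraMap R' _ (σ r) := by
  rw [algebraMap_apply, algebraMap_apply, map_mk, Algebra.TensorProduct.map_tmul, map_one]

lemma map_smul (r : R) (x : FirstOrder k R) : map σ (r • x) = σ r • map σ x := by
  rw [Algebra.smul_def, Algebra.smul_def, map_mul, map_algebraMap]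

lemma mul_map (x : FirstOrder k R) : mul k R' (map σ x) = σ (mul k R x) := by
  induction x using add_induction with
  | h a b =>
    rw [map_mul, map_right, map_algebraMap, map_mul, map_mul, mul_right, mul_right,
      AlgHom.commutes, AlgHom.commutes, map_mul]
    rfl
  | hadd x y hx hy => rw [map_add, map_add, hx, hy, map_add, map_add]

lemma map_id_apply (x : FirstOrder k R) (σ : R →ₐ[k] R) (h : ∀ r, σ r = r) : map σ x = x := by
  induction x using add_induction with
  | h a b => simp [h]
  | hadd x y hx hy => rw [map_add, hx, hy]

lemma map_comp_apply (x : FirstOrder k R) (ρ : R →ₐ[k] R'') (h : ∀ r, ρ r = τ (σ r)) :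
    map ρ x = map τ (map σ x) := by
  induction x using add_induction with
  | h a b => simp [h]
  | hadd x y hx hy => rw [map_add, hx, hy, map_add, map_add]

end FirstOrder

/-- The module of first order jets `(R ⊗ₖ R) ⧸ I² ⊗_R M`: the tensor product is formed along the
first factor of `R ⊗ₖ R`, and `R` acts on the result through the second factor. On an affine
scheme `Spec R` this is `p₂_* (p₁^* M ⊗ 𝒪 ⧸ I²)`. -/
def Jet (M : Type u) [AddCommGroup M] [Module R M] : Type u := FirstOrder k R ⊗[R] M

namespace Jet

variable (M : Type u) [AddCommGroup M] [Module R M]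

instance : AddCommGroup (Jet k R M) := inferInstanceAs (AddCommGroup (FirstOrder k R ⊗[R] M))

instance : Module (FirstOrder k R) (Jet k R M) :=
  inferInstanceAs (Module (FirstOrder k R) (FirstOrder k R ⊗[R] M))

instance : Module R (Jet k R M) := Module.compHom _ (FirstOrder.right k R)

variable {M}

lemma smul_def (r : R) (x : Jet k R M) : r • x = FirstOrder.right k R r • x := rfl

/-- The universal first order operator `m ↦ [1 ⊗ 1] ⊗ m`. -/
def prolong : M →+ Jet k R M :=
  (TensorProduct.mk R (FirstOrder k R) M 1).toAddMonoidHom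

lemma prolong_smul (r : R) (m : M) :
    prolong k R (r • m) = algebraMap R (FirstOrder k R) r • prolong k R m := by
  change (1 : FirstOrder k R) ⊗ₜ[R] (r • m) = (algebraMap R (FirstOrder k R) r * 1) ⊗ₜ[R] m
  rw [← TensorProduct.smul_tmul, Algebra.smul_def]

variable {k R}

@[elab_as_elim]
lemma add_induction {P : Jet k R M → Prop} (h : ∀ (x : FirstOrder k R) m, P (x • prolong k R m))
    (hadd : ∀ x y, P x → P y → P (x + y)) (x) : P x := by
  have h0 : P 0 := by
    have := h 0 0
    rwa [zero_smul] at this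
  induction x using TensorProduct.induction_on with
  | zero => exact h0
  | tmul x m =>
    have := h x m
    have h : x • prolong k R m = ((x * 1) ⊗ₜ[R] m : FirstOrder k R ⊗[R] M) := rfl
    rwa [h, mul_one] at this
  | add x y hx hy => exact hadd _ _ hx hy

/-- The additive map out of `Jet` attached to a balanced biadditive map. -/
def lift {N : Type*} [AddCommGroup N] (b : FirstOrder k R →+ M →+ N)
    (hb : ∀ (r : R) x m, b (r • x) m = b x (r • m)) : Jet k R M →+ N :=
  TensorProduct.liftAddHom b hb

lemma lift_smul_prolong {N : Type*} [AddCommGroup N] (b : FirstOrder k R →+ M →+ N)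
    (hb : ∀ (r : R) x m, b (r • x) m = b x (r • m)) (x : FirstOrder k R) (m : M) :
    lift b hb (x • prolong k R m) = b x m :=
  congrArg (fun y => b y m) (mul_one x)

variable (k R M)

/-- The projection as an additive map. -/
def projAux : Jet k R M →+ M :=
  lift ((smulAddHom R M).comp (FirstOrder.mul k R).toLinearMap.toAddMonoidHom)
    (fun r x m => (congrArg (· • m) (_root_.map_smul (FirstOrder.mul k R) r x)).trans
      ((congrArg (· • m) (mul_comm _ _)).trans (mul_smul _ _ _)))

lemma projAux_smul_prolong (x : FirstOrder k R) (m : M) :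
    projAux k R M (x • prolong k R m) = FirstOrder.mul k R x • m :=
  lift_smul_prolong _ _ _ _

/-- The projection `J₁(M) → M`, `[a ⊗ b] ⊗ m ↦ a b m`. -/
def proj : Jet k R M →ₗ[R] M :=
  { projAux k R M with
    map_smul' := by
      intro r x
      change projAux k R M (r • x) = r • projAux k R M x
      induction x using add_induction with
      | h x m =>
        rw [smul_def, smul_smul, projAux_smul_prolong, projAux_smul_prolong, map_mul,
          FirstOrder.mul_right, mul_smul]
      | hadd x y hx hy => rw [smul_add, map_add, map_add, hx, hy, smul_add] }

lemma proj_smul_prolong (x : FirstOrder k R) (m : M) :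
    proj k R M (x • prolong k R m) = FirstOrder.mul k R x • m :=
  projAux_smul_prolong k R M x m

/-- The inclusion `M ⊗ Ω → J₁(M)`, `m ⊗ dr ↦ [r ⊗ 1 - 1 ⊗ r] ⊗ m`. -/
def incl : M ⊗[R] Ω[R⁄k] →ₗ[R] Jet k R M :=
  TensorProduct.lift
  { toFun m :=
      { toFun ω := FirstOrder.ofDifferential k R ω • prolong k R m
        map_add' := by simp [add_smul]
        map_smul' := by intro r x; rw [← FirstOrder.right_mul_ofDifferential, mul_smul]; rfl }
    map_add' := by intro x y; ext; simp
    map_smul' := by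
      intro r x
      ext ω
      simp only [LinearMap.coe_mk, AddHom.coe_mk, prolong_smul, LinearMap.smul_apply,
        RingHom.id_apply, smul_def, smul_smul, FirstOrder.right_mul_ofDifferential]
      rw [_root_.map_smul, Algebra.smul_def, mul_comm] }

lemma incl_tmul (m : M) (ω : Ω[R⁄k]) :
    incl k R M (m ⊗ₜ ω) = FirstOrder.ofDifferential k R ω • prolong k R m := rfl

lemma incl_tmul_D (m : M) (r : R) :
    incl k R M (m ⊗ₜ KaehlerDifferential.D k R r) = prolong k R (r • m) - r • prolong k R m := by
  rw [incl_tmul, FirstOrder.ofDifferential_D, sub_smul, prolong_smul]; rfl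

/-- An additive retraction of `incl`. -/
def retr : Jet k R M →+ M ⊗[R] Ω[R⁄k] :=
  lift { toFun x := (((TensorProduct.mk R M Ω[R⁄k]).flip (FirstOrder.toDifferential k R x)).toAddMonoidHom)
         map_zero' := by ext; simp
         map_add' x y := by ext; simp }
    (fun r x m => by simp)

lemma retr_smul_prolong (x : FirstOrder k R) (m : M) :
    retr k R M (x • prolong k R m) = m ⊗ₜ FirstOrder.toDifferential k R x :=
  lift_smul_prolong _ _ _ _

lemma retr_incl (x : M ⊗[R] Ω[R⁄k]) : retr k R M (incl k R M x) = x := by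
  induction x using TensorProduct.induction_on with
  | zero => simp
  | tmul m x => rw [incl_tmul, retr_smul_prolong, FirstOrder.toDifferential_ofDifferential]
  | add x y hx hy => simp only [map_add, hx, hy]

lemma incl_retr (x : Jet k R M) :
    prolong k R (proj k R M x) + incl k R M (retr k R M x) = x := by
  induction x using add_induction with
  | h x m =>
    rw [proj_smul_prolong, retr_smul_prolong, incl_tmul, prolong_smul, ← add_smul,
      FirstOrder.ofDifferential_toDifferential]
  | hadd x y hx hy =>
    rw [map_add, map_add, map_add, map_add]
    conv_rhs => rw [← hx, ← hy]
    exact add_add_add_comm _ _ _ _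

lemma proj_prolong (m : M) : proj k R M (prolong k R m) = m := by
  have := proj_smul_prolong k R M 1 m
  rwa [one_smul, map_one, one_smul] at this

lemma proj_incl (x : M ⊗[R] Ω[R⁄k]) : proj k R M (incl k R M x) = 0 := by
  induction x using TensorProduct.induction_on with
  | zero => simp
  | tmul m x => rw [incl_tmul, proj_smul_prolong, FirstOrder.mul_ofDifferential, zero_smul]
  | add x y hx hy => rw [map_add, map_add, hx, hy, add_zero]

variable {k R M} {R' R'' : Type u} [CommRing R'] [Algebra k R'] (σ : R →ₐ[k] R')
  {M' : Type u} [AddCommGroup M'] [Module R' M']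

/-- The additive map induced by a semilinear map. -/
def map (ψ : M →+ M') (hψ : ∀ (r : R) m, ψ (r • m) = σ r • ψ m) : Jet k R M →+ Jet k R' M' :=
  lift { toFun x := (DistribSMul.toAddMonoidHom (Jet k R' M') (FirstOrder.map σ x)).comp
          ((prolong k R').comp ψ)
         map_zero' := by ext; simp
         map_add' x y := by ext; simp [add_smul] }
    (fun r x m => by
      simp [Algebra.smul_def, hψ, prolong_smul, smul_smul, mul_comm])

lemma map_smul_prolong (ψ : M →+ M') (hψ : ∀ (r : R) m, ψ (r • m) = σ r • ψ m)
    (x : FirstOrder k R) (m : M) :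
    map σ ψ hψ (x • prolong k R m) = FirstOrder.map σ x • prolong k R' (ψ m) :=
  lift_smul_prolong _ _ _ _

lemma map_smul (ψ : M →+ M') (hψ : ∀ (r : R) m, ψ (r • m) = σ r • ψ m) (r : R) (x : Jet k R M) :
    map σ ψ hψ (r • x) = σ r • map σ ψ hψ x := by
  induction x using add_induction with
  | h x m =>
    simp only [smul_def, smul_smul, map_smul_prolong, map_mul, FirstOrder.map_right]
  | hadd x y hx hy =>
    rw [smul_add, map_add, hx, hy, map_add, smul_add]

variable [CommRing R''] [Algebra k R''] (τ : R' →ₐ[k] R'')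
  {M'' : Type u} [AddCommGroup M''] [Module R'' M'']

lemma map_id_apply (σ : R →ₐ[k] R) (hσ : ∀ r, σ r = r) (ψ : M →+ M)
    (hψ : ∀ (r : R) m, ψ (r • m) = σ r • ψ m) (h : ∀ m, ψ m = m) (x : Jet k R M) :
    map σ ψ hψ x = x := by
  induction x using add_induction with
  | h x m => rw [map_smul_prolong, h, FirstOrder.map_id_apply _ _ hσ]
  | hadd x y hx hy => rw [map_add, hx, hy]

lemma map_comp_apply (ψ : M →+ M') (hψ : ∀ (r : R) m, ψ (r • m) = σ r • ψ m)
    (ψ' : M' →+ M'') (hψ' : ∀ (r : R') m, ψ' (r • m) = τ r • ψ' m)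
    (ρ : R →ₐ[k] R'') (hρ : ∀ r, ρ r = τ (σ r)) (χ : M →+ M'')
    (hχ : ∀ (r : R) m, χ (r • m) = ρ r • χ m) (h : ∀ m, χ m = ψ' (ψ m)) (x : Jet k R M) :
    map ρ χ hχ x = map τ ψ' hψ' (map σ ψ hψ x) := by
  induction x using add_induction with
  | h x m =>
    rw [map_smul_prolong, map_smul_prolong, map_smul_prolong, h,
      FirstOrder.map_comp_apply σ τ x ρ hρ]
  | hadd x y hx hy => rw [map_add, hx, hy, map_add, map_add]

lemma proj_map (ψ : M →+ M') (hψ : ∀ (r : R) m, ψ (r • m) = σ r • ψ m) (x : Jet k R M) :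
    proj k R' M' (map σ ψ hψ x) = ψ (proj k R M x) := by
  induction x using add_induction with
  | h x m =>
    rw [map_smul_prolong, proj_smul_prolong, proj_smul_prolong, hψ, FirstOrder.mul_map]
  | hadd x y hx hy => rw [map_add, map_add, map_add, map_add, hx, hy]

lemma map_incl_tmul_D (ψ : M →+ M') (hψ : ∀ (r : R) m, ψ (r • m) = σ r • ψ m) (m : M) (r : R) :
    map σ ψ hψ (incl k R M (m ⊗ₜ KaehlerDifferential.D k R r)) =
      incl k R' M' (ψ m ⊗ₜ KaehlerDifferential.D k R' (σ r)) := by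
  rw [incl_tmul, incl_tmul, map_smul_prolong, FirstOrder.ofDifferential_D,
    FirstOrder.ofDifferential_D, map_sub, FirstOrder.map_algebraMap, FirstOrder.map_right]

lemma map_prolong (ψ : M →+ M') (hψ : ∀ (r : R) m, ψ (r • m) = σ r • ψ m) (m : M) :
    map σ ψ hψ (prolong k R m) = prolong k R' (ψ m) := by
  have := map_smul_prolong σ ψ hψ 1 m
  rwa [one_smul, map_one, one_smul] at this

lemma map_add_apply (ψ : M →+ M') (hψ : ∀ (r : R) m, ψ (r • m) = σ r • ψ m)
    (ψ' : M →+ M') (hψ' : ∀ (r : R) m, ψ' (r • m) = σ r • ψ' m)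
    (χ : M →+ M') (hχ : ∀ (r : R) m, χ (r • m) = σ r • χ m) (h : ∀ m, χ m = ψ m + ψ' m)
    (x : Jet k R M) : map σ χ hχ x = map σ ψ hψ x + map σ ψ' hψ' x := by
  induction x using add_induction with
  | h x m => rw [map_smul_prolong, map_smul_prolong, map_smul_prolong, h, map_add, smul_add]
  | hadd x y hx hy => rw [map_add, map_add, map_add, hx, hy, add_add_add_comm]

/-- An additive induction principle. -/
lemma tensor_induction {P : M ⊗[R] Ω[R⁄k] → Prop}
    (h : ∀ m (r : R), P (m ⊗ₜ KaehlerDifferential.D k R r))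
    (hadd : ∀ x y, P x → P y → P (x + y)) (x : M ⊗[R] Ω[R⁄k]) : P x := by
  have h0 : P 0 := by simpa using h 0 0
  induction x using TensorProduct.induction_on with
  | zero => exact h0
  | tmul m ω =>
    have := KaehlerDifferential.span_range_derivation k R
    have hω : ω ∈ Submodule.span R (Set.range (KaehlerDifferential.D k R)) := by
      rw [this]; trivial
    induction hω using Submodule.span_induction generalizing m with
    | mem x hx => obtain ⟨r, rfl⟩ := hx; exact h m r
    | zero => simpa using h0
    | add x y _ _ hx hy => rw [TensorProduct.tmul_add]; exact hadd _ _ (hx m) (hy m)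
    | smul a x _ hx => rw [TensorProduct.tmul_smul, TensorProduct.smul_tmul']; exact hx _
  | add x y hx hy => exact hadd _ _ hx hy

end Jet
end Ring
section Presheaf
open CategoryTheory MonoidalCategory
universe u v w
variable {C : Type w} [Category.{v} C] {A : CommRingCat.{u}} {R : Cᵒᵖ ⥤ CommRingCat.{u}}
  (φ : (Functor.const Cᵒᵖ).obj A ⟶ R)

/-! Sections over `U` of the presheaves `M ⊗ Ω` and `J₁(M)`, for a presheaf of modules `M` over a
presheaf of commutative `A`-algebras `R`, are `M(U) ⊗ Ω_{R(U)/A}` and `J₁(M(U))`. -/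

namespace PresheafJet

/-- The `A`-algebra structure on `R(U)`. -/
abbrev algebra (U : Cᵒᵖ) : Algebra A (R.obj U) := (φ.app U).hom.toAlgebra

def algHom {U V : Cᵒᵖ} (i : U ⟶ V) :
    letI := algebra φ U
    letI := algebra φ V
    R.obj U →ₐ[A] R.obj V :=
  letI := algebra φ U
  letI := algebra φ V
  { (R.map i).hom with
    commutes' a := by
      have := φ.naturality i
      exact (congrArg (fun f => f.hom a) this).symm }

open PresheafOfModules

variable {M N P : PresheafOfModules.{u} (R ⋙ forget₂ CommRingCat RingCat)}

variable (M) in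
/-- The sections of `M` over `U`. -/
def sec (U : Cᵒᵖ) : Type u := M.obj U

instance (U : Cᵒᵖ) : AddCommGroup (sec M U) := inferInstanceAs (AddCommGroup (M.obj U))
instance (U : Cᵒᵖ) : Module (R.obj U) (sec M U) :=
  inferInstanceAs (Module ((R ⋙ forget₂ CommRingCat RingCat).obj U) (M.obj U))

variable (M) in
def res {U V : Cᵒᵖ} (i : U ⟶ V) : sec M U →+ sec M V := (M.map i).hom.toAddMonoidHom

lemma res_smul {U V : Cᵒᵖ} (i : U ⟶ V) (r : R.obj U) (m : sec M U) :
    res M i (r • m) = R.map i r • res M i m := M.map_smul i r m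

lemma res_id (U : Cᵒᵖ) (m : sec M U) : res M (𝟙 U) m = m :=
  congrArg (fun f => f.hom m) (M.map_id U)

lemma res_comp {U V W : Cᵒᵖ} (i : U ⟶ V) (j : V ⟶ W) (m : sec M U) :
    res M (i ≫ j) m = res M j (res M i m) :=
  congrArg (fun f => f.hom m) (M.map_comp i j)

def ev (f : M ⟶ N) (U : Cᵒᵖ) : sec M U →ₗ[R.obj U] sec N U := (f.app U).hom

lemma ev_res (f : M ⟶ N) {U V : Cᵒᵖ} (i : U ⟶ V) (m : sec M U) :
    ev f V (res M i m) = res N i (ev f U m) :=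
  congrArg (fun f => f.hom m) (f.naturality i)

lemma ev_id (U : Cᵒᵖ) (m : sec M U) : ev (𝟙 M) U m = m := rfl
lemma ev_comp (f : M ⟶ N) (g : N ⟶ P) (U : Cᵒᵖ) (m : sec M U) :
    ev (f ≫ g) U m = ev g U (ev f U m) := rfl

variable (M) in
abbrev JetSec (U : Cᵒᵖ) : Type u :=
  letI := algebra φ U
  Jet A (R.obj U) (sec M U)

variable (M) in
def jetMap {U V : Cᵒᵖ} (i : U ⟶ V) : JetSec φ M U →+ JetSec φ M V :=
  letI := algebra φ U
  letI := algebra φ V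
  Jet.map (algHom φ i) (res M i) (res_smul i)

lemma jetMap_smul {U V : Cᵒᵖ} (i : U ⟶ V) (r : R.obj U) (x : JetSec φ M U) :
    jetMap φ M i (r • x) = R.map i r • jetMap φ M i x :=
  letI := algebra φ U
  letI := algebra φ V
  Jet.map_smul (algHom φ i) (res M i) (res_smul i) r x

lemma jetMap_id (U : Cᵒᵖ) (x : JetSec φ M U) : jetMap φ M (𝟙 U) x = x :=
  letI := algebra φ U
  Jet.map_id_apply (algHom φ (𝟙 U)) (fun r => congrArg (fun f => f.hom r) (R.map_id U)) _ _
    (res_id U) x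

lemma jetMap_comp {U V W : Cᵒᵖ} (i : U ⟶ V) (j : V ⟶ W) (x : JetSec φ M U) :
    jetMap φ M (i ≫ j) x = jetMap φ M j (jetMap φ M i x) :=
  letI := algebra φ U
  letI := algebra φ V
  letI := algebra φ W
  Jet.map_comp_apply (algHom φ i) (algHom φ j) _ _ _ _ (algHom φ (i ≫ j))
    (fun r => congrArg (fun f => f.hom r) (R.map_comp i j)) _ _ (res_comp i j) x

def jetEv (f : M ⟶ N) (U : Cᵒᵖ) : JetSec φ M U →ₗ[R.obj U] JetSec φ N U :=
  letI := algebra φ U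
  { Jet.map (AlgHom.id A (R.obj U)) (ev f U).toAddMonoidHom (ev f U).map_smul with
    map_smul' := Jet.map_smul (AlgHom.id A (R.obj U)) _ _ }

lemma jetEv_jetMap (f : M ⟶ N) {U V : Cᵒᵖ} (i : U ⟶ V) (x : JetSec φ M U) :
    jetEv φ f V (jetMap φ M i x) = jetMap φ N i (jetEv φ f U x) := by
  let := algebra φ U
  let := algebra φ V
  have h : ∀ (r : R.obj U) (m : sec M U), ((ev f V).toAddMonoidHom.comp (res M i)) (r • m) =
      algHom φ i r • ((ev f V).toAddMonoidHom.comp (res M i)) m := fun r m =>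
    (congrArg (ev f V) (res_smul i r m)).trans ((ev f V).map_smul _ _)
  exact (Jet.map_comp_apply (algHom φ i) (AlgHom.id A (R.obj V)) (res M i) (res_smul i)
    (ev f V).toAddMonoidHom (ev f V).map_smul (algHom φ i) (fun _ => rfl) _ h
    (fun _ => rfl) x).symm.trans
    (Jet.map_comp_apply (AlgHom.id A (R.obj U)) (algHom φ i) (ev f U).toAddMonoidHom
      (ev f U).map_smul (res N i) (res_smul i) (algHom φ i) (fun _ => rfl) _ h (ev_res f i) x)

lemma jetEv_id (U : Cᵒᵖ) (x : JetSec φ M U) : jetEv φ (𝟙 M) U x = x :=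
  letI := algebra φ U
  Jet.map_id_apply (AlgHom.id A (R.obj U)) (fun _ => rfl) (ev (𝟙 M) U).toAddMonoidHom
    (ev (𝟙 M) U).map_smul (ev_id U) x

lemma jetEv_comp (f : M ⟶ N) (g : N ⟶ P) (U : Cᵒᵖ) (x : JetSec φ M U) :
    jetEv φ (f ≫ g) U x = jetEv φ g U (jetEv φ f U x) :=
  letI := algebra φ U
  Jet.map_comp_apply (AlgHom.id A (R.obj U)) (AlgHom.id A (R.obj U)) (ev f U).toAddMonoidHom
    (ev f U).map_smul (ev g U).toAddMonoidHom (ev g U).map_smul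
    (AlgHom.id A (R.obj U)) (fun _ => rfl) (ev (f ≫ g) U).toAddMonoidHom (ev (f ≫ g) U).map_smul
    (ev_comp f g U) x

variable (M) in
def jetAb : Cᵒᵖ ⥤ Ab.{u} where
  obj U := AddCommGrpCat.of (JetSec φ M U)
  map i := AddCommGrpCat.ofHom (jetMap φ M i)
  map_id U := by ext x; exact jetMap_id φ U x
  map_comp i j := by ext x; exact jetMap_comp φ i j x

instance (U : Cᵒᵖ) : Module ((R ⋙ forget₂ CommRingCat RingCat).obj U) ((jetAb φ M).obj U) :=
  inferInstanceAs (Module (R.obj U) (JetSec φ M U))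

variable (M) in
def jetObj : PresheafOfModules.{u} (R ⋙ forget₂ CommRingCat RingCat) :=
  ofPresheaf (jetAb φ M) (fun _ _ i r x => jetMap_smul φ i r x)

def jetHom (f : M ⟶ N) : jetObj φ M ⟶ jetObj φ N :=
  homMk { app U := AddCommGrpCat.ofHom (jetEv φ f U).toAddMonoidHom
          naturality U V i := by ext x; exact jetEv_jetMap φ f i x }
    (fun U r x => (jetEv φ f U).map_smul r x)

/-- The functor `M ↦ J₁(M)` on presheaves of modules. -/
def jet : PresheafOfModules.{u} (R ⋙ forget₂ CommRingCat RingCat) ⥤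
    PresheafOfModules.{u} (R ⋙ forget₂ CommRingCat RingCat) where
  obj M := jetObj φ M
  map f := jetHom φ f
  map_id M := by ext U x; exact jetEv_id φ U x
  map_comp f g := by ext U x; exact jetEv_comp φ f g U x

/-- The functor `M ↦ M ⊗ Ω` on presheaves of modules. -/
def twist : PresheafOfModules.{u} (R ⋙ forget₂ CommRingCat RingCat) ⥤
    PresheafOfModules.{u} (R ⋙ forget₂ CommRingCat RingCat) :=
  tensorRight (DifferentialsConstruction.relativeDifferentials' φ)

variable (M) in
def projEv (U : Cᵒᵖ) : JetSec φ M U →ₗ[R.obj U] sec M U :=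
  letI := algebra φ U
  Jet.proj A (R.obj U) (sec M U)

lemma projEv_jetMap {U V : Cᵒᵖ} (i : U ⟶ V) (x : JetSec φ M U) :
    projEv φ M V (jetMap φ M i x) = res M i (projEv φ M U x) :=
  letI := algebra φ U
  letI := algebra φ V
  Jet.proj_map (algHom φ i) (res M i) (res_smul i) x

lemma projEv_jetEv (f : M ⟶ N) (U : Cᵒᵖ) (x : JetSec φ M U) :
    projEv φ N U (jetEv φ f U x) = ev f U (projEv φ M U x) :=
  letI := algebra φ U
  Jet.proj_map (AlgHom.id A (R.obj U)) (ev f U).toAddMonoidHom (ev f U).map_smul x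

variable (M) in
def projApp : jetObj φ M ⟶ M :=
  homMk { app U := AddCommGrpCat.ofHom (projEv φ M U).toAddMonoidHom
          naturality U V i := by ext x; exact projEv_jetMap φ i x }
    (fun U r x => (projEv φ M U).map_smul r x)

/-- The projection `J₁(M) ⟶ M`. -/
def proj : jet φ ⟶ 𝟭 _ where
  app M := projApp φ M
  naturality M N f := by ext U x; exact projEv_jetEv φ f U x

variable (M) in
abbrev TwistSec (U : Cᵒᵖ) : Type u :=
  letI := algebra φ U
  sec M U ⊗[R.obj U] Ω[R.obj U⁄A]

variable {φ} in
/-- The section `m ⊗ dr`. -/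
def tmulD {U : Cᵒᵖ} (m : sec M U) (r : R.obj U) : TwistSec φ M U :=
  letI := algebra φ U
  m ⊗ₜ KaehlerDifferential.D A (R.obj U) r

def twistMap {U V : Cᵒᵖ} (i : U ⟶ V) : TwistSec φ M U →+ TwistSec φ M V :=
  (((twist φ).obj M).map i).hom.toAddMonoidHom

lemma twistMap_tmulD {U V : Cᵒᵖ} (i : U ⟶ V) (m : sec M U) (r : R.obj U) :
    twistMap φ i (tmulD m r) = tmulD (res M i m) (R.map i r) :=
  letI := algebra φ V
  congrArg (fun ω => (res M i m) ⊗ₜ[R.obj V] ω)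
    (DifferentialsConstruction.relativeDifferentials'_map_d φ i r)

def twistEv (f : M ⟶ N) (U : Cᵒᵖ) : TwistSec φ M U →+ TwistSec φ N U :=
  (((twist φ).map f).app U).hom.toAddMonoidHom

lemma twistEv_tmulD (f : M ⟶ N) (U : Cᵒᵖ) (m : sec M U) (r : R.obj U) :
    twistEv φ f U (tmulD m r) = tmulD (ev f U m) r := rfl

variable (M) in
def inclEv (U : Cᵒᵖ) : TwistSec φ M U →ₗ[R.obj U] JetSec φ M U :=
  letI := algebra φ U
  Jet.incl A (R.obj U) (sec M U)

lemma twist_hom_ext {T : Type*} [AddCommGroup T] {U : Cᵒᵖ} {f g : TwistSec φ M U →+ T}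
    (h : ∀ m r, f (tmulD m r) = g (tmulD m r)) (x : TwistSec φ M U) : f x = g x := by
  let := algebra φ U
  induction x using Jet.tensor_induction with
  | h m r => exact h m r
  | hadd x y hx hy => rw [map_add, map_add, hx, hy]

lemma inclEv_twistMap {U V : Cᵒᵖ} (i : U ⟶ V) (x : TwistSec φ M U) :
    inclEv φ M V (twistMap φ i x) = jetMap φ M i (inclEv φ M U x) := by
  let := algebra φ U
  let := algebra φ V
  refine twist_hom_ext φ (f := (inclEv φ M V).toAddMonoidHom.comp (twistMap φ i))
    (g := (jetMap φ M i).comp (inclEv φ M U).toAddMonoidHom) (fun m r => ?_) x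
  exact (congrArg (inclEv φ M V) (twistMap_tmulD φ i m r)).trans
    (Jet.map_incl_tmul_D (algHom φ i) (res M i) (res_smul i) m r).symm

lemma inclEv_twistEv (f : M ⟶ N) (U : Cᵒᵖ) (x : TwistSec φ M U) :
    inclEv φ N U (twistEv φ f U x) = jetEv φ f U (inclEv φ M U x) := by
  let := algebra φ U
  refine twist_hom_ext φ (f := (inclEv φ N U).toAddMonoidHom.comp (twistEv φ f U))
    (g := (jetEv φ f U).toAddMonoidHom.comp (inclEv φ M U).toAddMonoidHom) (fun m r => ?_) x
  exact (Jet.map_incl_tmul_D (AlgHom.id A (R.obj U)) (ev f U).toAddMonoidHom (ev f U).map_smul m r).symm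

variable (M) in
def inclApp : (twist φ).obj M ⟶ jetObj φ M :=
  homMk { app U := AddCommGrpCat.ofHom (inclEv φ M U).toAddMonoidHom
          naturality U V i := by ext x; exact inclEv_twistMap φ i x }
    (fun U r x => (inclEv φ M U).map_smul r x)

/-- The inclusion `M ⊗ Ω ⟶ J₁(M)`. -/
def incl : twist φ ⟶ jet φ where
  app M := inclApp φ M
  naturality M N f := by ext U x; exact inclEv_twistEv φ f U x

instance : (twist φ).Additive where
  map_add {M N f g} := by
    ext U x
    refine twist_hom_ext φ (f := twistEv φ (f + g) U) (g := twistEv φ f U + twistEv φ g U)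
      (fun m r => ?_) x
    let := algebra φ U
    exact TensorProduct.add_tmul (R := R.obj U) (ev f U m) (ev g U m)
      (KaehlerDifferential.D A (R.obj U) r)

instance : (jet φ).Additive where
  map_add {M N f g} := by
    ext U x
    let := algebra φ U
    exact Jet.map_add_apply (AlgHom.id A (R.obj U)) (ev f U).toAddMonoidHom (ev f U).map_smul
      (ev g U).toAddMonoidHom (ev g U).map_smul (ev (f + g) U).toAddMonoidHom
      (ev (f + g) U).map_smul (fun _ => rfl) x

lemma incl_comp_proj : (incl φ).app M ≫ (proj φ).app M = 0 := by
  ext U x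
  let := algebra φ U
  exact Jet.proj_incl A (R.obj U) (sec M U) x

variable (M) in
abbrev shortComplex : ShortComplex (PresheafOfModules.{u} (R ⋙ forget₂ CommRingCat RingCat)) :=
  ShortComplex.mk ((incl φ).app M) ((proj φ).app M) (incl_comp_proj φ)

variable (M) in
/-- The universal first order operator. -/
def prolong (U : Cᵒᵖ) : sec M U →+ JetSec φ M U :=
  letI := algebra φ U
  Jet.prolong A (R.obj U)

lemma prolong_res {U V : Cᵒᵖ} (i : U ⟶ V) (m : sec M U) :
    prolong φ M V (res M i m) = jetMap φ M i (prolong φ M U m) := by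
  let := algebra φ U
  let := algebra φ V
  exact (Jet.map_prolong (algHom φ i) (res M i) (res_smul i) m).symm

variable (M) in
def retr (U : Cᵒᵖ) : JetSec φ M U →+ TwistSec φ M U :=
  letI := algebra φ U
  Jet.retr A (R.obj U) (sec M U)

lemma retr_inclEv (U : Cᵒᵖ) (x : TwistSec φ M U) : retr φ M U (inclEv φ M U x) = x :=
  letI := algebra φ U
  Jet.retr_incl A (R.obj U) (sec M U) x

lemma inclEv_retr (U : Cᵒᵖ) (x : JetSec φ M U) :
    prolong φ M U (projEv φ M U x) + inclEv φ M U (retr φ M U x) = x :=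
  letI := algebra φ U
  Jet.incl_retr A (R.obj U) (sec M U) x

lemma projEv_prolong (U : Cᵒᵖ) (m : sec M U) : projEv φ M U (prolong φ M U m) = m :=
  letI := algebra φ U
  Jet.proj_prolong A (R.obj U) (sec M U) m

lemma retr_jetMap {U V : Cᵒᵖ} (i : U ⟶ V) (x : JetSec φ M U) :
    retr φ M V (jetMap φ M i x) = twistMap φ i (retr φ M U x) := by
  have h := inclEv_retr φ U x
  have h1 := congrArg (retr φ M V) (congrArg (jetMap φ M i) h)
  have h2 := inclEv_retr φ V (jetMap φ M i x)
  have hinj : Function.Injective (inclEv φ M V) :=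
    Function.LeftInverse.injective (retr_inclEv φ V)
  apply hinj
  rw [inclEv_twistMap]
  have h3 : jetMap φ M i x = prolong φ M V (projEv φ M V (jetMap φ M i x)) +
      jetMap φ M i (inclEv φ M U (retr φ M U x)) := by
    rw [projEv_jetMap, prolong_res, ← map_add, h]
  exact add_left_cancel (h2.trans h3)

lemma shortExact : (shortComplex φ M).ShortExact := by
  let F := PresheafOfModules.toPresheaf.{u} (R ⋙ forget₂ CommRingCat RingCat)
  let σ : ((shortComplex φ M).map F).Splitting :=
    { r := { app U := AddCommGrpCat.ofHom (retr φ M U)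
             naturality U V i := by ext x; exact retr_jetMap φ i x }
      s := { app U := AddCommGrpCat.ofHom (prolong φ M U)
             naturality U V i := by ext x; exact prolong_res φ i x }
      f_r := by ext U x; exact retr_inclEv φ U x
      s_g := by ext U x; exact projEv_prolong φ U x
      id := by ext U x; exact (add_comm _ _).trans (inclEv_retr φ U x) }
  have h := σ.shortExact
  have : Mono (F.map ((incl φ).app M)) := h.mono_f
  have : Epi (F.map ((proj φ).app M)) := h.epi_g
  exact { exact := ((shortComplex φ M).exact_map_iff_of_faithful F).1 h.exact
          mono_f := F.mono_of_mono_map inferInstance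
          epi_g := F.epi_of_epi_map inferInstance }

end PresheafJet

end Presheaf
section Sheaf
open CategoryTheory AlgebraicGeometry
universe u
variable {k : Type u} [CommRing k] {X : Scheme.{u}} (f : X ⟶ Spec (CommRingCat.of k))

namespace AtiyahClass

/-- The structure morphism `k ⟶ 𝒪_X`, as a morphism of presheaves of rings. -/
def scalars : (Functor.const _).obj (CommRingCat.of k) ⟶ X.presheaf where
  app U := (Scheme.ΓSpecIso (CommRingCat.of k)).inv ≫ f.appTop ≫ X.presheaf.map (homOfLE le_top).op
  naturality U V i := by
    simp only [Functor.const_obj_obj, Functor.const_obj_map, Category.id_comp, Category.assoc]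
    rw [← Functor.map_comp]
    rfl

variable (X) in
/-- Presheaves of `𝒪_X`-modules. -/
abbrev PMod : Type (u + 1) := PresheafOfModules.{u} (X.presheaf ⋙ forget₂ CommRingCat RingCat)

variable (X) in
/-- Sheafification. -/
def sheafify : PMod X ⥤ X.Modules :=
  (PresheafOfModules.sheafification (𝟙 X.ringCatSheaf.obj) :
    X.PresheafOfModules ⥤ SheafOfModules X.ringCatSheaf)

variable (X) in
/-- The underlying presheaf. -/
def forget : X.Modules ⥤ PMod X := Scheme.Modules.toPresheafOfModules X

variable (X) in
/-- Sheafification is left adjoint to the underlying presheaf. -/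
def adj : sheafify X ⊣ forget X :=
  PresheafOfModules.sheafificationAdjunction (𝟙 X.ringCatSheaf.obj)

instance : IsIso (adj X).counit :=
  inferInstanceAs (IsIso (PresheafOfModules.sheafificationAdjunction (𝟙 X.ringCatSheaf.obj)).counit)

/-- The functor `E ↦ E ⊗ Ω_{X/k}`: the sheaf associated with `U ↦ E(U) ⊗ Ω_{𝒪(U)/k}`. -/
def twist : X.Modules ⥤ X.Modules := forget X ⋙ PresheafJet.twist (scalars f) ⋙ sheafify X

/-- The functor `E ↦ J₁(E)`: the sheaf associated with `U ↦ J₁(E(U))`. -/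
def jet : X.Modules ⥤ X.Modules := forget X ⋙ PresheafJet.jet (scalars f) ⋙ sheafify X

/-- The inclusion `E ⊗ Ω_{X/k} ⟶ J₁(E)`. -/
def incl : twist f ⟶ jet f :=
  Functor.whiskerLeft (forget X) (Functor.whiskerRight (PresheafJet.incl (scalars f)) (sheafify X))

/-- The projection `J₁(E) ⟶ E`. -/
def proj : jet f ⟶ 𝟭 X.Modules :=
  Functor.whiskerLeft (forget X) (Functor.whiskerRight (PresheafJet.proj (scalars f)) (sheafify X))
   ≫ (adj X).counit

instance : (forget X).Additive where
instance : (sheafify X).Additive := (adj X).left_adjoint_additive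
instance : (twist f).Additive := by unfold twist; infer_instance
instance : (jet f).Additive := by unfold jet; infer_instance
instance : Limits.PreservesFiniteLimits (sheafify X) :=
  inferInstanceAs (Limits.PreservesFiniteLimits
    (PresheafOfModules.sheafification (𝟙 X.ringCatSheaf.obj)))
instance : Limits.PreservesFiniteColimits (sheafify X) := by
  have := (adj X).leftAdjoint_preservesColimits
  infer_instance

lemma incl_comp_proj (E : X.Modules) : (incl f).app E ≫ (proj f).app E = 0 := by
  have h := PresheafJet.incl_comp_proj (scalars f) (M := (forget X).obj E)
  have h' := (((sheafify X).map_comp _ _).symm.trans (congrArg (sheafify X).map h)).trans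
    (Functor.map_zero _ _ _)
  exact (Category.assoc _ _ _).symm.trans ((congrArg (· ≫ (adj X).counit.app E) h').trans
    Limits.zero_comp)

lemma shortExact (E : X.Modules) :
    (ShortComplex.mk ((incl f).app E) ((proj f).app E) (incl_comp_proj f E)).ShortExact := by
  have h := (PresheafJet.shortExact (scalars f) (M := (forget X).obj E)).map_of_exact (sheafify X)
  refine ShortComplex.shortExact_of_iso (S₂ := ShortComplex.mk ((incl f).app E) ((proj f).app E)
    (incl_comp_proj f E)) ?_ h
  exact ShortComplex.isoMk (S₁ := (PresheafJet.shortComplex (scalars f)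
    ((forget X).obj E)).map (sheafify X)) (S₂ := ShortComplex.mk ((incl f).app E) ((proj f).app E)
    (incl_comp_proj f E)) (Iso.refl ((twist f).obj E)) (Iso.refl ((jet f).obj E))
    ((asIso (adj X).counit).app E) ((Category.id_comp _).trans (Category.comp_id _).symm)
    (Category.id_comp _)

end AtiyahClass
end Sheaf
section Homological
open CategoryTheory Limits
universe v u w
variable {𝒜 : Type u} [Category.{v} 𝒜]

namespace AtiyahClass

section
variable [Preadditive 𝒜]

/-- The shifted complex `K[1]`, with `K[1]ⁿ = Kⁿ⁺¹` and the differential of `K`, without a sign. -/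
def shiftOne (K : CochainComplex 𝒜 ℤ) : CochainComplex 𝒜 ℤ where
  X n := K.X (n + 1)
  d i j := K.d (i + 1) (j + 1)
  shape i j h := K.shape _ _ (fun h' => h (by simp only [ComplexShape.up_Rel] at *; lia))

lemma isStrictlyGE_shiftOne {n : ℤ} (K : CochainComplex 𝒜 ℤ) [K.IsStrictlyGE n] :
    (shiftOne K).IsStrictlyGE (n - 1) := by
  rw [CochainComplex.isStrictlyGE_iff]
  intro i hi
  exact K.isZero_of_isStrictlyGE n (i + 1) (by lia)

variable [HasBinaryBiproducts 𝒜] {K L M : CochainComplex 𝒜 ℤ}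

/-- The differential `(x, y) ↦ (d x + (-1) ^ n • φ y, d y)` of the total complex. -/
def totD (φ : K ⟶ L) (n : ℤ) : L.X n ⊞ K.X (n + 1) ⟶ L.X (n + 1) ⊞ K.X (n + 1 + 1) :=
  biprod.desc (L.d n (n + 1) ≫ biprod.inl)
    (n.negOnePow • (φ.f (n + 1) ≫ biprod.inl) + K.d (n + 1) (n + 1 + 1) ≫ biprod.inr)

variable (φ : K ⟶ L)

/-- The total complex `Tot(φ : K ⟶ L)`, with `Totⁿ = Lⁿ ⊕ Kⁿ⁺¹` and differential
`(x, y) ↦ (d x + (-1) ^ n • φ y, d y)`. -/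
def tot : CochainComplex 𝒜 ℤ :=
  CochainComplex.of (fun n => L.X n ⊞ K.X (n + 1)) (totD φ)
    (fun n => by
      dsimp only [totD]
      ext <;> simp [Int.negOnePow_succ])

lemma tot_d (n : ℤ) : (tot φ).d n (n + 1) = totD φ n :=
  CochainComplex.of_d (fun n => L.X n ⊞ K.X (n + 1)) (totD φ) n

/-- The morphism `Tot(φ) ⟶ M`, `(x, y) ↦ g x`. -/
def totDesc (g : L ⟶ M) (h : φ ≫ g = 0) : tot φ ⟶ M where
  f n := (biprod.fst ≫ g.f n : L.X n ⊞ K.X (n + 1) ⟶ M.X n)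
  comm' i j hij := by
    obtain rfl : i + 1 = j := hij
    have h' : φ.f (i + 1) ≫ g.f (i + 1) = 0 := by
      rw [← HomologicalComplex.comp_f, h, HomologicalComplex.zero_f]
    have key : (biprod.fst ≫ g.f i : L.X i ⊞ K.X (i + 1) ⟶ _) ≫ M.d i (i + 1) =
        totD φ i ≫ biprod.fst ≫ g.f (i + 1) := by
      dsimp only [totD]
      ext <;> simp [h']
    exact key.trans (congrArg (· ≫ _) (tot_d φ i).symm)

/-- The morphism `Tot(φ) ⟶ K[1]`, `(x, y) ↦ y`. -/
def totSnd : tot φ ⟶ shiftOne K where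
  f n := (biprod.snd : L.X n ⊞ K.X (n + 1) ⟶ K.X (n + 1))
  comm' i j hij := by
    obtain rfl : i + 1 = j := hij
    have key : (biprod.snd : L.X i ⊞ K.X (i + 1) ⟶ _) ≫ K.d (i + 1) (i + 1 + 1) =
        totD φ i ≫ biprod.snd := by
      dsimp only [totD]
      ext <;> simp
    exact key.trans (congrArg (· ≫ _) (tot_d φ i).symm)

open CochainComplex

/-- The comparison of the mapping cone with `Tot(φ)`, in degree `n`. -/
def coneToTotX (n : ℤ) : (mappingCone φ).X n ⟶ L.X n ⊞ K.X (n + 1) :=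
  (mappingCone.snd φ).v n n (add_zero n) ≫ biprod.inl +
    n.negOnePow • ((mappingCone.fst φ).1.v n (n + 1) rfl ≫ biprod.inr)

/-- The inverse of the comparison, in degree `n`. -/
def totToConeX (n : ℤ) : L.X n ⊞ K.X (n + 1) ⟶ (mappingCone φ).X n :=
  biprod.desc ((mappingCone.inr φ).f n)
    (n.negOnePow • (mappingCone.inl φ).v (n + 1) n (by lia))

lemma coneToTotX_totToConeX (n : ℤ) : coneToTotX φ n ≫ totToConeX φ n = 𝟙 _ := by
  rw [← mappingCone.id_X φ n (n + 1) rfl]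
  simp [coneToTotX, totToConeX, smul_smul, add_comm]

lemma totToConeX_coneToTotX (n : ℤ) : totToConeX φ n ≫ coneToTotX φ n = 𝟙 _ := by
  ext <;> simp [coneToTotX, totToConeX, smul_smul]

lemma coneToTotX_totD (n : ℤ) :
    coneToTotX φ n ≫ totD φ n = (mappingCone φ).d n (n + 1) ≫ coneToTotX φ (n + 1) := by
  ext
  · simp [coneToTotX, totD, smul_smul, mappingCone.d_snd_v φ n (n + 1) rfl, add_comm]
  · simp [coneToTotX, totD, smul_smul, mappingCone.d_fst_v φ n (n + 1) (n + 1 + 1) rfl rfl,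
      Int.negOnePow_succ]

lemma coneToTotX_tot_d (n : ℤ) :
    (coneToTotX φ n : (mappingCone φ).X n ⟶ (tot φ).X n) ≫ (tot φ).d n (n + 1) =
      (mappingCone φ).d n (n + 1) ≫ coneToTotX φ (n + 1) := by
  rw [tot_d]
  exact coneToTotX_totD φ n

/-- The comparison of the mapping cone with `Tot(φ)`. -/
def coneToTot : mappingCone φ ⟶ tot φ where
  f := coneToTotX φ
  comm' i j h := by
    obtain rfl : i + 1 = j := h
    exact coneToTotX_tot_d φ i

instance (n : ℤ) : IsIso ((coneToTot φ).f n) :=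
  ⟨totToConeX φ n, coneToTotX_totToConeX φ n, totToConeX_coneToTotX φ n⟩

instance : IsIso (coneToTot φ) := HomologicalComplex.Hom.isIso_of_components _

lemma coneToTotX_fst (n : ℤ) :
    coneToTotX φ n ≫ biprod.fst = (mappingCone.snd φ).v n n (add_zero n) := by
  simp [coneToTotX]

lemma isStrictlyGE_tot {n : ℤ} [K.IsStrictlyGE n] [L.IsStrictlyGE n] :
    (tot φ).IsStrictlyGE (n - 1) := by
  rw [isStrictlyGE_iff]
  intro i hi
  exact (biprod_isZero_iff _ _).2 ⟨L.isZero_of_isStrictlyGE n i (by lia),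
    K.isZero_of_isStrictlyGE n (i + 1) (by lia)⟩

end

section
variable [Preadditive 𝒜] [HasBinaryBiproducts 𝒜]

/-- `K[1]`, for a bounded below complex `K`. -/
def shiftOnePlus (K : CochainComplex.Plus 𝒜) : CochainComplex.Plus 𝒜 :=
  ⟨shiftOne K.obj, by
    obtain ⟨n, hn⟩ := K.property
    exact ⟨n - 1, isStrictlyGE_shiftOne K.obj⟩⟩

/-- `Tot(φ)`, for a morphism `φ` of bounded below complexes. -/
def totPlus {K L : CochainComplex.Plus 𝒜} (φ : K ⟶ L) : CochainComplex.Plus 𝒜 :=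
  ⟨tot φ.hom, by
    obtain ⟨n, hn⟩ := K.property
    obtain ⟨m, hm⟩ := L.property
    have := K.obj.isStrictlyGE_of_ge (min n m) n (min_le_left _ _)
    have := L.obj.isStrictlyGE_of_ge (min n m) m (min_le_right _ _)
    exact ⟨min n m - 1, isStrictlyGE_tot φ.hom⟩⟩

end

section
variable [Abelian 𝒜]

open CochainComplex in
lemma coneToTot_totDesc (S : ShortComplex (CochainComplex 𝒜 ℤ)) :
    coneToTot S.f ≫ totDesc S.f S.g S.zero = mappingCone.descShortComplex S := by
  refine HomologicalComplex.hom_ext _ _ (fun n => ?_)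
  have key : (coneToTotX S.f n ≫ biprod.fst) ≫ S.g.f n =
      (mappingCone.descShortComplex S).f n := by
    rw [coneToTotX_fst]
    apply mappingCone.ext_from S.f (n + 1) n rfl
    · rw [mappingCone.inl_v_snd_v_assoc, mappingCone.inl_v_descShortComplex_f, zero_comp]
    · rw [mappingCone.inr_f_snd_v_assoc, mappingCone.inr_f_descShortComplex_f]
  exact (Category.assoc _ _ _).symm.trans key

lemma quasiIso_totDesc {S : ShortComplex (CochainComplex 𝒜 ℤ)} (hS : S.ShortExact) :
    QuasiIso (totDesc S.f S.g S.zero) := by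
  have := CochainComplex.mappingCone.quasiIso_descShortComplex hS
  have h : QuasiIso (coneToTot S.f ≫ totDesc S.f S.g S.zero) := by
    rw [coneToTot_totDesc]; exact this
  exact quasiIso_of_comp_left (coneToTot S.f) _

lemma isIso_plusQ [HasDerivedCategory.{w} 𝒜] {K L : CochainComplex.Plus 𝒜} (φ : K ⟶ L)
    (h : QuasiIso φ.hom) : IsIso (DerivedCategory.Plus.Q.map φ) := by
  have h1 : IsIso (DerivedCategory.Q.map φ.hom) := inferInstance
  have h2 : IsIso (DerivedCategory.Qh.map ((HomotopyCategory.quotient _ _).map φ.hom)) :=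
    ((MorphismProperty.isomorphisms _).arrow_mk_iso_iff
      ((Functor.mapArrowFunctor _ _).mapIso (DerivedCategory.quotientCompQhIso 𝒜) |>.app
        (Arrow.mk φ.hom))).2 h1
  have h3 : IsIso (DerivedCategory.Plus.ι.map (DerivedCategory.Plus.Q.map φ)) := h2
  exact isIso_of_fully_faithful DerivedCategory.Plus.ι _

end

end AtiyahClass
end Homological
section Main
open CategoryTheory AlgebraicGeometry TopologicalSpace
universe w u

namespace AtiyahClass

/-- A vector bundle: an `𝒪_X`-module which is locally free of finite rank. -/
def IsVectorBundle {X : Scheme.{u}} (E : X.Modules) : Prop :=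
  ∀ x : X, ∃ U : X.Opens, x ∈ U ∧ ∃ n : ℕ,
    Nonempty (E.restrict U.ι ≅
      (SheafOfModules.free (ULift.{u} (Fin n)) : U.toScheme.Modules))

variable {k : Type u} [CommRing k] {X : Scheme.{u}} (f : X ⟶ Spec (CommRingCat.of k))

/-- The local section `e ⊗ dr` of `E ⊗ Ω_{X/k}`. -/
def tmulD {E : X.Modules} {U : X.Opens} (e : Γ(E, U)) (r : Γ(X, U)) : Γ((twist f).obj E, U) :=
  (((adj X).unit.app ((PresheafJet.twist (scalars f)).obj ((forget X).obj E))).app (.op U)).hom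
    (PresheafJet.tmulD (φ := scalars f) (M := (forget X).obj E) (U := .op U) e r)

/-- A connection on `E` relative to `k`: a `k`-linear morphism of sheaves `∇ : E ⟶ E ⊗ Ω_{X/k}`
such that `∇ (r • e) = r • ∇ e + e ⊗ dr` for all local sections `r` of `𝒪_X` and `e` of `E`. -/
structure Connection (E : X.Modules) where
  app (U : X.Opens) : Γ(E, U) →+ Γ((twist f).obj E, U)
  naturality {U V : X.Opens} (i : U ⟶ V) (e : Γ(E, V)) :
    app U (E.presheaf.map i.op e) = ((twist f).obj E).presheaf.map i.op (app V e)
  scalar_smul {U : X.Opens} (c : k) (e : Γ(E, U)) :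
    app U ((scalars f).app (.op U) c • e) = (scalars f).app (.op U) c • app U e
  leibniz {U : X.Opens} (r : Γ(X, U)) (e : Γ(E, U)) :
    app U (r • e) = r • app U e + tmulD f e r

variable (E : CochainComplex.Plus X.Modules)

/-- The complex `E ⊗ Ω_{X/k}`, with differential `d ⊗ 1`. -/
def twistPlus : CochainComplex.Plus X.Modules := (twist f).mapCochainComplexPlus.obj E

/-- The complex `J₁(E)`. -/
def jetPlus : CochainComplex.Plus X.Modules := (jet f).mapCochainComplexPlus.obj E

/-- The inclusion of complexes `E ⊗ Ω_{X/k} ⟶ J₁(E)`. -/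
def inclPlus : twistPlus f E ⟶ jetPlus f E :=
  ObjectProperty.homMk
    { f := fun n => (incl f).app (E.obj.X n)
      comm' := fun i j _ => ((incl f).naturality (E.obj.d i j)).symm }

/-- The projection of complexes `J₁(E) ⟶ E`. -/
def projPlus : jetPlus f E ⟶ E :=
  ObjectProperty.homMk
    { f := fun n => (proj f).app (E.obj.X n)
      comm' := fun i j _ => ((proj f).naturality (E.obj.d i j)).symm }

lemma inclPlus_projPlus : (inclPlus f E).hom ≫ (projPlus f E).hom = 0 :=
  HomologicalComplex.hom_ext _ _ (fun n => incl_comp_proj f (E.obj.X n))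

lemma shortExact_plus : (ShortComplex.mk (inclPlus f E).hom (projPlus f E).hom
    (inclPlus_projPlus f E)).ShortExact :=
  HomologicalComplex.shortExact_of_degreewise_shortExact _ (fun n => shortExact f (E.obj.X n))

/-- The quasi-isomorphism `Tot(E ⊗ Ω ⟶ J₁(E)) ⟶ E` given by `(x, y) ↦ g x`. -/
def totDescPlus : totPlus (inclPlus f E) ⟶ E :=
  ObjectProperty.homMk (totDesc (inclPlus f E).hom (projPlus f E).hom (inclPlus_projPlus f E))

/-- The projection `Tot(E ⊗ Ω ⟶ J₁(E)) ⟶ (E ⊗ Ω)[1]` given by `(x, y) ↦ y`. -/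
def totSndPlus : totPlus (inclPlus f E) ⟶ shiftOnePlus (twistPlus f E) :=
  ObjectProperty.homMk (totSnd (inclPlus f E).hom)

variable [HasDerivedCategory.{w} X.Modules]

instance : IsIso (DerivedCategory.Plus.Q.map (totDescPlus f E)) :=
  isIso_plusQ _ (quasiIso_totDesc (shortExact_plus f E))

/-- The Atiyah class of `E` in `Hom_{D⁺}(E, (E ⊗ Ω)[1])`: the connecting morphism
`E ← Tot(E ⊗ Ω ⟶ J₁(E)) → (E ⊗ Ω)[1]` of the exact sequence of complexes
`0 ⟶ E ⊗ Ω ⟶ J₁(E) ⟶ E ⟶ 0`. -/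
def atiyahClass :
    DerivedCategory.Plus.Q.obj E ⟶ DerivedCategory.Plus.Q.obj (shiftOnePlus (twistPlus f E)) :=
  inv (DerivedCategory.Plus.Q.map (totDescPlus f E)) ≫
    DerivedCategory.Plus.Q.map (totSndPlus f E)

end AtiyahClass
end Main
end

open CategoryTheory AlgebraicGeometry AtiyahClass
universe w u

/-! A connection is the same thing as a linear splitting of the jet sequence. The operator `j : E →
J₁(E)`, `e ↦ [1 ⊗ 1] ⊗ e`, is an additive section of `g`, but `𝒪_X` acts on jets through the second
factor, so `j (r e) = r j e + f (e ⊗ dr)`. The Leibniz rule gives `f ∇` the same defect, hence `s =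
j - f ∇` is an `𝒪_X`-linear section of `g` (`Connection.prolong_sub_smul`,
`Connection.jetSection_proj`).

Apply this to every term of the complex. The sections `sₙ` need not commute with the differentials,
but `sₙ₊₁ d - J₁(d) sₙ` is killed by `g`, so it is `f` of a unique linear map. As `j` and `f` are
natural, this map is `-∇ d + (d ⊗ 1) ∇`, that is, `(-1)ⁿ θₙ` (`Connection.commutator_app`).
Linearity of `θₙ` thus comes from the exact sequence, and compatibility with the differentials
follows from `d² = 0` and injectivity of `f` (`obstruction_comm`).

The relation `sₙ₊₁ d = J₁(d) sₙ + (-1)ⁿ f θₙ` says exactly that `σ : e ↦ (sₙ e, θₙ e)` is a morphism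
of complexes from `E` to `Tot`. It satisfies `Q σ = 1` and `R σ = θ` (`totSection_totDescPlus`,
`totSection_totSndPlus`). In the derived category `Q` is invertible, so `σ = Q⁻¹` and `R Q⁻¹ = R σ =
θ`. -/

noncomputable section

/-! ### Lifting a morphism to the total complex from degreewise sections -/

section Homological
open Limits
universe v
variable {𝒜 : Type u} [Category.{v} 𝒜] [Preadditive 𝒜]

namespace AtiyahClass

variable {K L M : CochainComplex 𝒜 ℤ} (φ : K ⟶ L)

/-- A family of morphisms `tₙ` measuring the failure of sections `sₙ` to commute with the
differentials is a morphism of complexes. -/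
lemma obstruction_comm [∀ n, Mono (φ.f n)] (s : ∀ n, M.X n ⟶ L.X n)
    (t : ∀ n, M.X n ⟶ K.X (n + 1))
    (hst : ∀ n, s n ≫ L.d n (n + 1) + n.negOnePow • (t n ≫ φ.f (n + 1)) =
      M.d n (n + 1) ≫ s (n + 1)) (n : ℤ) :
    t n ≫ K.d (n + 1) (n + 1 + 1) = M.d n (n + 1) ≫ t (n + 1) := by
  -- Since `φ` is mono, the identity may be checked in `L`. There both sides are compared with `d s
  -- d`: `h1` is the relation in degree `n` followed by `d`, `h2` is the relation in degree `n + 1`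
  -- preceded by `d`, and `d² = 0` removes one term from each.
  rw [← cancel_mono (φ.f (n + 1 + 1))]
  have h1 := congrArg (· ≫ L.d (n + 1) (n + 1 + 1)) (hst n)
  have h2 := congrArg (M.d n (n + 1) ≫ ·) (hst (n + 1))
  simp only [Preadditive.add_comp, Category.assoc, HomologicalComplex.d_comp_d, comp_zero,
    zero_add, Linear.units_smul_comp, φ.comm, Int.negOnePow_succ, Preadditive.comp_add,
    HomologicalComplex.d_comp_d_assoc, zero_comp,
    Linear.comp_units_smul, Preadditive.comp_neg, Units.neg_smul] at h1 h2
  rw [← h1, add_neg_eq_zero] at h2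
  -- Both sides of `h2` carry the sign `(-1)ⁿ`, which is its own inverse.
  have h3 := congrArg (n.negOnePow • ·) h2
  simpa only [smul_smul, Int.units_mul_self, one_smul, Category.assoc] using h3

variable [HasBinaryBiproducts 𝒜]

/-- The two hypotheses are the two coordinates of the conclusion; the sign in `hst` is the one in
`totD`. -/
lemma lift_totD (s : ∀ n, M.X n ⟶ L.X n) (t : ∀ n, M.X n ⟶ K.X (n + 1)) (n : ℤ)
    (hst : s n ≫ L.d n (n + 1) + n.negOnePow • (t n ≫ φ.f (n + 1)) = M.d n (n + 1) ≫ s (n + 1))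
    (ht : t n ≫ K.d (n + 1) (n + 1 + 1) = M.d n (n + 1) ≫ t (n + 1)) :
    biprod.lift (s n) (t n) ≫ totD φ n = M.d n (n + 1) ≫ biprod.lift (s (n + 1)) (t (n + 1)) := by
  dsimp only [totD]
  ext
  · simpa using hst
  · simpa using ht

/-- The morphism `e ↦ (s e, t e)` to the total complex. -/
def totLift (s : ∀ n, M.X n ⟶ L.X n) (t : M ⟶ shiftOne K)
    (hst : ∀ n, s n ≫ L.d n (n + 1) + n.negOnePow • ((t.f n : M.X n ⟶ K.X (n + 1)) ≫ φ.f (n + 1)) =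
      M.d n (n + 1) ≫ s (n + 1)) : M ⟶ tot φ where
  f n := (biprod.lift (s n) (t.f n) : M.X n ⟶ L.X n ⊞ K.X (n + 1))
  comm' i j hij := by
    obtain rfl : i + 1 = j := hij
    exact (congrArg (_ ≫ ·) (tot_d φ i)).trans
      (lift_totD φ s t.f i (hst i) (t.comm i (i + 1)))

variable (s : ∀ n, M.X n ⟶ L.X n) (t : M ⟶ shiftOne K)
    (hst : ∀ n, s n ≫ L.d n (n + 1) + n.negOnePow • ((t.f n : M.X n ⟶ K.X (n + 1)) ≫ φ.f (n + 1)) =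
      M.d n (n + 1) ≫ s (n + 1))

lemma totLift_totSnd : totLift φ s t hst ≫ totSnd φ = t :=
  HomologicalComplex.hom_ext _ _ (fun _ => biprod.lift_snd _ _)

/-- Sections in each degree suffice, although they need not form a morphism of complexes: `totDesc`
sees only the first coordinate, and the second one absorbs the defect. -/
lemma totLift_totDesc (g : L ⟶ M) (h : φ ≫ g = 0) (hs : ∀ n, s n ≫ g.f n = 𝟙 _) :
    totLift φ s t hst ≫ totDesc φ g h = 𝟙 M :=
  HomologicalComplex.hom_ext _ _ (fun n => (biprod.lift_fst_assoc _ _ _).trans (hs n))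

end AtiyahClass
end Homological

/-! ### The Leibniz defect of the universal operator on presheaves -/

section Presheaf
universe v

/-- Moving `r` across the tensor product makes it act through the first factor, while the module
structure of `Jet` uses the second; the difference `[r ⊗ 1 - 1 ⊗ r]` is the image of `dr`. -/
lemma Jet.prolong_smul_eq (k R : Type u) [CommRing k] [CommRing R] [Algebra k R]
    {M : Type u} [AddCommGroup M] [Module R M] (r : R) (m : M) :
    prolong k R (r • m) = r • prolong k R m + incl k R M (m ⊗ₜ KaehlerDifferential.D k R r) := by
  rw [incl_tmul_D, add_sub_cancel]

namespace PresheafJet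
variable {C : Type w} [Category.{v} C] {A : CommRingCat.{u}} {R : Cᵒᵖ ⥤ CommRingCat.{u}}
  (φ : (Functor.const Cᵒᵖ).obj A ⟶ R)
  {M N : PresheafOfModules.{u} (R ⋙ forget₂ CommRingCat RingCat)}

lemma prolong_smul (U : Cᵒᵖ) (r : R.obj U) (m : sec M U) :
    prolong φ M U (r • m) = r • prolong φ M U m + inclEv φ M U (tmulD m r) :=
  letI := algebra φ U
  Jet.prolong_smul_eq A (R.obj U) r m

lemma jetEv_prolong (f : M ⟶ N) (U : Cᵒᵖ) (m : sec M U) :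
    jetEv φ f U (prolong φ M U m) = prolong φ N U (ev f U m) :=
  letI := algebra φ U
  Jet.map_prolong (AlgHom.id A (R.obj U)) (ev f U).toAddMonoidHom (ev f U).map_smul m

end PresheafJet
end Presheaf

/-! ### Connections as linear splittings of the jet sequence of sheaves -/

section Sheaf

namespace AtiyahClass
variable {k : Type u} [CommRing k] {X : Scheme.{u}} (f : X ⟶ Spec (CommRingCat.of k))

/-- The map from sections of a presheaf of modules to sections of the associated sheaf. -/
def toSheafify (P : PMod X) (U : X.Opens) : P.obj (.op U) →+ Γ((sheafify X).obj P, U) :=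
  (((adj X).unit.app P).app (.op U)).hom.toAddMonoidHom

lemma toSheafify_map {P Q : PMod X} (g : P ⟶ Q) (U : X.Opens) (x : P.obj (.op U)) :
    ((sheafify X).map g).app U (toSheafify P U x) = toSheafify Q U ((g.app (.op U)).hom x) :=
  congrArg (fun h => (PresheafOfModules.Hom.app h (.op U)).hom x)
    ((adj X).unit.naturality g).symm

lemma toSheafify_res (P : PMod X) {U V : X.Opens} (i : U ⟶ V) (x : P.obj (.op V)) :
    toSheafify P U ((P.map i.op).hom x) =
      ((sheafify X).obj P).presheaf.map i.op (toSheafify P V x) :=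
  congrArg (fun h => h.hom x) (((adj X).unit.app P).naturality i.op)

lemma toSheafify_smul (P : PMod X) (U : X.Opens) (r : Γ(X, U)) (x : P.obj (.op U)) :
    toSheafify P U ((show (X.presheaf ⋙ forget₂ CommRingCat RingCat).obj (.op U) from r) • x) =
      r • toSheafify P U x :=
  (((adj X).unit.app P).app (.op U)).hom.map_smul _ _

lemma counit_toSheafify (E : X.Modules) (U : X.Opens) (x : Γ(E, U)) :
    ((adj X).counit.app E).app U (toSheafify ((forget X).obj E) U x) = x :=
  congrArg (fun h => (PresheafOfModules.Hom.app h (.op U)).hom x)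
    ((adj X).right_triangle_components E)

/-- The universal first order operator `E ⟶ J₁(E)`. -/
def prolong (E : X.Modules) (U : X.Opens) : Γ(E, U) →+ Γ((jet f).obj E, U) :=
  -- The operator is only additive, so it is not a morphism of modules to which `sheafify` applies.
  -- Since `E` is already a sheaf, composing with the unit on sections is enough.
  (toSheafify ((PresheafJet.jet (scalars f)).obj ((forget X).obj E)) U).comp
    (PresheafJet.prolong (scalars f) ((forget X).obj E) (.op U))

lemma prolong_res (E : X.Modules) {U V : X.Opens} (i : U ⟶ V) (e : Γ(E, V)) :
    prolong f E U (E.presheaf.map i.op e) = ((jet f).obj E).presheaf.map i.op (prolong f E V e) :=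
  (congrArg (toSheafify ((PresheafJet.jet (scalars f)).obj ((forget X).obj E)) U)
    (PresheafJet.prolong_res (scalars f) i.op e)).trans
    (toSheafify_res ((PresheafJet.jet (scalars f)).obj ((forget X).obj E)) i
      (PresheafJet.prolong (scalars f) ((forget X).obj E) (.op V) e))

lemma jet_map_prolong {E F : X.Modules} (g : E ⟶ F) (U : X.Opens) (e : Γ(E, U)) :
    ((jet f).map g).app U (prolong f E U e) = prolong f F U (g.app U e) :=
  (toSheafify_map _ U _).trans
    (congrArg (toSheafify ((PresheafJet.jet (scalars f)).obj ((forget X).obj F)) U)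
      (PresheafJet.jetEv_prolong (scalars f) ((forget X).map g) (.op U) e))

/-- On sections coming from the presheaf, `proj` is the presheaf projection followed by unit and
counit, and these cancel by the triangle identity. -/
lemma proj_prolong (E : X.Modules) (U : X.Opens) (e : Γ(E, U)) :
    ((proj f).app E).app U (prolong f E U e) = e :=
  (congrArg (((adj X).counit.app E).app U) ((toSheafify_map _ U _).trans
    (congrArg (toSheafify ((forget X).obj E) U)
      (PresheafJet.projEv_prolong (scalars f) (.op U) e)))).trans (counit_toSheafify E U e)

lemma incl_tmulD (E : X.Modules) (U : X.Opens) (e : Γ(E, U)) (r : Γ(X, U)) :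
    ((incl f).app E).app U (tmulD f e r) =
      toSheafify ((PresheafJet.jet (scalars f)).obj ((forget X).obj E)) U
        (PresheafJet.inclEv (scalars f) ((forget X).obj E) (.op U) (PresheafJet.tmulD e r)) :=
  toSheafify_map _ U _

lemma prolong_smul (E : X.Modules) (U : X.Opens) (r : Γ(X, U)) (e : Γ(E, U)) :
    prolong f E U (r • e) = r • prolong f E U e + ((incl f).app E).app U (tmulD f e r) := by
  rw [incl_tmulD]
  have h := congrArg (toSheafify ((PresheafJet.jet (scalars f)).obj ((forget X).obj E)) U)
    (PresheafJet.prolong_smul (scalars f) (.op U) r e)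
  exact h.trans ((map_add (toSheafify ((PresheafJet.jet (scalars f)).obj ((forget X).obj E)) U)
    _ _).trans (congrArg (· + _) (toSheafify_smul
      ((PresheafJet.jet (scalars f)).obj ((forget X).obj E)) U r
      (PresheafJet.prolong (scalars f) ((forget X).obj E) (.op U) e))))

instance (E : X.Modules) : Mono ((incl f).app E) := (shortExact f E).mono_f

/-- Passing to presheaves of abelian groups and evaluating on `U` both preserve monomorphisms.
Equalities in `E ⊗ Ω` can therefore be tested on sections of `J₁(E)`. -/
lemma injective_app_of_mono {E F : X.Modules} (g : E ⟶ F) [Mono g] (U : X.Opens) :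
    Function.Injective (g.app U) := by
  have h : Mono ((Scheme.Modules.toPresheaf X).map g) := inferInstance
  have h' : Mono (((Scheme.Modules.toPresheaf X).map g).app (.op U)) := inferInstance
  exact (AddCommGrpCat.mono_iff_injective _).1 h'

lemma hom_app_res {E F : X.Modules} (g : E ⟶ F) {U V : X.Opens} (i : U ⟶ V) (e : Γ(E, V)) :
    g.app U (E.presheaf.map i.op e) = F.presheaf.map i.op (g.app V e) :=
  congrArg (fun h => h.hom e) (g.mapPresheaf.naturality i.op)

variable {f} in
-- The two operators fail to be linear by the same term `f (e ⊗ dr)`, which cancels in the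
-- difference.
lemma Connection.prolong_sub_smul {E : X.Modules} (D : Connection f E) (U : X.Opens) (r : Γ(X, U))
    (e : Γ(E, U)) :
    prolong f E U (r • e) - ((incl f).app E).app U (D.app U (r • e)) =
      r • (prolong f E U e - ((incl f).app E).app U (D.app U e)) := by
  rw [prolong_smul, D.leibniz, map_add, Scheme.Modules.Hom.app_smul, add_sub_add_right_eq_sub,
    smul_sub]

variable {f} in
/-- The `𝒪_X`-linear section `e ↦ j e - ∇ e` of `J₁(E) ⟶ E` defined by a connection `∇`. -/
def Connection.jetSection {E : X.Modules} (D : Connection f E) : E ⟶ (jet f).obj E :=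
  ⟨PresheafOfModules.homMk (M₁ := E.val) (M₂ := ((jet f).obj E).val)
    { app U := AddCommGrpCat.ofHom (prolong f E U.unop -
        (((incl f).app E).app U.unop).hom.comp (D.app U.unop))
      naturality U V i := by
        ext e
        have h := (prolong_res f E i.unop e)
        have h' := (congrArg (((incl f).app E).app V.unop) (D.naturality i.unop e)).trans
          (hom_app_res _ i.unop _)
        exact (congrArg₂ (· - ·) h h').trans
          (map_sub (((jet f).obj E).presheaf.map i).hom _ _).symm }
    (fun U r e => D.prolong_sub_smul U.unop r e)⟩

variable {f} in
lemma Connection.jetSection_app {E : X.Modules} (D : Connection f E) (U : X.Opens) (e : Γ(E, U)) :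
    D.jetSection.app U e = prolong f E U e - ((incl f).app E).app U (D.app U e) := rfl

variable {f} in
lemma Connection.jetSection_proj {E : X.Modules} (D : Connection f E) :
    D.jetSection ≫ (proj f).app E = 𝟙 E := by
  ext U e
  have h : ((proj f).app E).app U (((incl f).app E).app U (D.app U e)) = 0 :=
    congrArg (fun h => Scheme.Modules.Hom.app h U (D.app U e)) (incl_comp_proj f E)
  change ((proj f).app E).app U (D.jetSection.app U e) = e
  rw [D.jetSection_app, map_sub, proj_prolong, h, sub_zero]

variable {f} in
/-- For a morphism `d` of modules with connections, the `𝒪_X`-linear map `-∇ d + (d ⊗ 1) ∇`. -/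
def Connection.commutator {E F : X.Modules} (D : Connection f E) (D' : Connection f F)
    (d : E ⟶ F) : E ⟶ (twist f).obj F :=
  -- Both composites project to `d`, by naturality of `proj` and because the jet sections split it.
  -- Their difference lands in the kernel `F ⊗ Ω`, and the factorization is automatically
  -- `𝒪_X`-linear.
  (shortExact f F).exact.lift (d ≫ D'.jetSection - D.jetSection ≫ (jet f).map d) (by
    have h : (jet f).map d ≫ (proj f).app F = (proj f).app E ≫ d := (proj f).naturality d
    have h' := D.jetSection_proj
    dsimp only at h' ⊢
    rw [Preadditive.sub_comp, Category.assoc, Category.assoc, h, D'.jetSection_proj,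
      reassoc_of% h', Category.comp_id, sub_self])

variable {f} in
lemma Connection.commutator_incl {E F : X.Modules} (D : Connection f E) (D' : Connection f F)
    (d : E ⟶ F) : D.commutator D' d ≫ (incl f).app F =
      d ≫ D'.jetSection - D.jetSection ≫ (jet f).map d :=
  (shortExact f F).exact.lift_f _ _

variable {f} in
lemma Connection.commutator_app {E F : X.Modules} (D : Connection f E) (D' : Connection f F)
    (d : E ⟶ F) (U : X.Opens) (e : Γ(E, U)) :
    (D.commutator D' d).app U e =
      -D'.app U (d.app U e) + ((twist f).map d).app U (D.app U e) := by
  apply injective_app_of_mono ((incl f).app F) U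
  have h : ((incl f).app F).app U ((D.commutator D' d).app U e) =
      D'.jetSection.app U (d.app U e) - ((jet f).map d).app U (D.jetSection.app U e) :=
    congrArg (fun h => Scheme.Modules.Hom.app h U e) (D.commutator_incl D' d)
  have h' : ((jet f).map d).app U (((incl f).app E).app U (D.app U e)) =
      ((incl f).app F).app U (((twist f).map d).app U (D.app U e)) :=
    (congrArg (fun h => Scheme.Modules.Hom.app h U (D.app U e)) ((incl f).naturality d)).symm
  -- By naturality both universal operator terms become `prolong (d e)` and cancel; only the
  -- connection terms survive.
  rw [h, D'.jetSection_app, D.jetSection_app, map_sub, jet_map_prolong, h', map_add, map_neg]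
  abel

end AtiyahClass
end Sheaf

/-! ### The morphism `θ` and the section of the total complex -/

section Main

namespace AtiyahClass
variable {k : Type u} [CommRing k] {X : Scheme.{u}} {f : X ⟶ Spec (CommRingCat.of k)}
  (E : CochainComplex.Plus X.Modules) (nabla : ∀ n : ℤ, Connection f (E.obj.X n))

/-- The morphisms `θₙ = (-1)ⁿ (-∇ d + (d ⊗ 1) ∇)`. -/
def thetaX (n : ℤ) : E.obj.X n ⟶ (twist f).obj (E.obj.X (n + 1)) :=
  n.negOnePow • (nabla n).commutator (nabla (n + 1)) (E.obj.d n (n + 1))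

/-- The sign in `thetaX` and the sign of the total differential multiply to `1`, leaving the
defining property of the commutator. -/
lemma jetSection_d (n : ℤ) :
    (nabla n).jetSection ≫ (jetPlus f E).obj.d n (n + 1) +
      n.negOnePow • (thetaX E nabla n ≫ (inclPlus f E).hom.f (n + 1)) =
        E.obj.d n (n + 1) ≫ (nabla (n + 1)).jetSection := by
  have h := (nabla n).commutator_incl (nabla (n + 1)) (E.obj.d n (n + 1))
  change (nabla n).jetSection ≫ (jet f).map (E.obj.d n (n + 1)) +
    n.negOnePow • ((n.negOnePow • (nabla n).commutator (nabla (n + 1)) (E.obj.d n (n + 1))) ≫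
      (incl f).app (E.obj.X (n + 1))) = _
  rw [Linear.units_smul_comp, smul_smul, Int.units_mul_self, one_smul, h, add_sub_cancel]

instance (n : ℤ) : Mono ((inclPlus f E).hom.f n) :=
  inferInstanceAs (Mono ((incl f).app (E.obj.X n)))

/-- The morphism of complexes `θ : E ⟶ (E ⊗ Ω)[1]`. -/
def theta : E ⟶ shiftOnePlus (twistPlus f E) :=
  ObjectProperty.homMk
    { f := thetaX E nabla
      comm' := by
        rintro i _ rfl
        exact obstruction_comm (inclPlus f E).hom (fun n => (nabla n).jetSection)
          (thetaX E nabla) (jetSection_d E nabla) i }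

/-- The section of `Tot(E ⊗ Ω ⟶ J₁(E)) ⟶ E` defined by connections on the terms of `E`. -/
def totSection : E ⟶ totPlus (inclPlus f E) :=
  ObjectProperty.homMk (totLift (inclPlus f E).hom (fun n => (nabla n).jetSection)
    (theta E nabla).hom (jetSection_d E nabla))

lemma totSection_totDescPlus : totSection E nabla ≫ totDescPlus f E = 𝟙 E :=
  ObjectProperty.hom_ext _ (totLift_totDesc _ _ _ (jetSection_d E nabla) _
    (inclPlus_projPlus f E) (fun n => (nabla n).jetSection_proj))

lemma totSection_totSndPlus : totSection E nabla ≫ totSndPlus f E = theta E nabla :=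
  ObjectProperty.hom_ext _ (totLift_totSnd _ _ _ (jetSection_d E nabla))

end AtiyahClass
end Main
end

theorem proposition6 {k : Type u} [Field k] [CharZero k] {X : Scheme.{u}}
    (f : X ⟶ Spec (CommRingCat.of k)) [Smooth f] [HasDerivedCategory.{w} X.Modules]
    (E : CochainComplex.Plus X.Modules) (hE : ∀ n : ℤ, IsVectorBundle (E.obj.X n))
    (nabla : ∀ n : ℤ, Connection f (E.obj.X n)) :
    ∃ θ : E ⟶ shiftOnePlus (twistPlus f E),
      (∀ (n : ℤ) (U : X.Opens) (e : Γ(E.obj.X n, U)),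
        Scheme.Modules.Hom.app (θ.hom.f n) U e =
          n.negOnePow • (-(nabla (n + 1)).app U ((E.obj.d n (n + 1)).app U e) +
            ((twist f).map (E.obj.d n (n + 1))).app U ((nabla n).app U e))) ∧
      atiyahClass f E = DerivedCategory.Plus.Q.map θ := by
  refine ⟨theta E nabla, fun n U e => ?_, ?_⟩
  · rw [← Connection.commutator_app]
    change (n.negOnePow • (nabla n).commutator (nabla (n + 1)) (E.obj.d n (n + 1))).app U e = _
    -- The sign acts on morphisms on one side and on sections on the other; the two actions are
    -- compared for `1` and `-1` separately.
    rcases Int.units_eq_one_or n.negOnePow with h | h <;> rw [h]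
    · rw [one_smul, one_smul]
    · rw [Units.neg_smul, Units.neg_smul, one_smul, one_smul]
      rfl
  · rw [atiyahClass, IsIso.inv_comp_eq, ← totSection_totSndPlus E nabla, Functor.map_comp,
      ← Category.assoc]
    -- A one-sided inverse of an isomorphism is its inverse, so the section represents `Q⁻¹`.
    have h : DerivedCategory.Plus.Q.map (totSection E nabla) =
        inv (DerivedCategory.Plus.Q.map (totDescPlus f E)) := by
      rw [← cancel_mono (DerivedCategory.Plus.Q.map (totDescPlus f E)), IsIso.inv_hom_id,
        ← Functor.map_comp, totSection_totDescPlus, CategoryTheory.Functor.map_id]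
    rw [h, IsIso.hom_inv_id, Category.id_comp]
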